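/- Let $\sigma_k(n)=\sum_{d\mid n}d^k$ (sum over the positive divisors of $n$), $\sigma=\sigma_1$, and for $z$ in the upper half plane $\mathbb{H}$ put $q=e^{2\pi i z}$, $$E_2(z)=1-24\sum_{n\ge1}\sigma(n)q^n,\qquad E_4(z)=1+240\sum_{n\ge1}\sigma_3(n)q^n,$$ and, for a positive integer $d$, $L_d(z)=E_2(z)-d\,E_2(dz)$. Let $S_4(\Gamma_0(N))$ denote the space of cusp forms of weight $4$ for $\Gamma_0(N)$. (1) Let $p$ be a prime. Then there exists a cusp form $C_{(1,p)}\in S_4(\Gamma_0(p))$ such that for all $z\in\mathbb{H}$ $$(L_p(z))^2=\frac{(p-1)^2}{p^2+1}E_4(z)+\frac{p^2(p-1)^2}{p^2+1}E_4(pz)+C_{(1,p)}(z).$$ (2) Let $p_1\neq p_2$ be primes. Then there exist cusp forms $C_{(p_1,p_2)},\,C_{(1,p_1p_2)}\in S_4(\Gamma_0(p_1p_2))$ such that for all $z\in\mathbb{H}$ $$\begin{aligned}L_{p_1}(z)L_{p_2}(z)={}&\frac{(p_1^2-p_1+1)(p_2^2-p_2+1)}{(p_1^2+1)(p_2^2+1)}E_4(z)-\frac{p_1^3(p_2^2-p_2+1)}{(p_1^2+1)(p_2^2+1)}E_4(p_1z)\\&-\frac{p_2^3(p_1^2-p_1+1)}{(p_1^2+1)(p_2^2+1)}E_4(p_2z)+\frac{p_1^3p_2^3}{(p_1^2+1)(p_2^2+1)}E_4(p_1p_2z)+C_{(p_1,p_2)}(z)\end{aligned}$$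 and $$\begin{aligned}(L_{p_1p_2}(z))^2={}&\left(1-\frac{2p_1p_2}{(p_1^2+1)(p_2^2+1)}\right)E_4(z)-\frac{2p_1^3p_2}{(p_1^2+1)(p_2^2+1)}E_4(p_1z)\\&-\frac{2p_1p_2^3}{(p_1^2+1)(p_2^2+1)}E_4(p_2z)+\left(p_1^2p_2^2-\frac{2p_1^3p_2^3}{(p_1^2+1)(p_2^2+1)}\right)E_4(p_1p_2z)+C_{(1,p_1p_2)}(z).\end{aligned}$$ -/

import Mathlib

open UpperHalfPlane CongruenceSubgroup
open scoped MatrixGroups ArithmeticFunction.sigma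

noncomputable section

namespace EisensteinConvolution

/-- The weight `2` Eisenstein series `E_2(z) = 1 - 24 ∑_{n ≥ 1} σ(n) q^n`, `q = e^{2πiz}`, used
for `z` in the upper half plane. Taking `z : ℂ` lets `E_2(dz)` be written `E2 (d * z)`. -/
def E2 (z : ℂ) : ℂ :=
  1 - 24 * ∑' n : ℕ+, (σ 1 n : ℂ) * Complex.exp (2 * Real.pi * Complex.I * z) ^ (n : ℕ)

/-- The weight `4` Eisenstein series `E_4(z) = 1 + 240 ∑_{n ≥ 1} σ_3(n) q^n`, `q = e^{2πiz}`,
used for `z` in the upper half plane. -/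
def E4 (z : ℂ) : ℂ :=
  1 + 240 * ∑' n : ℕ+, (σ 3 n : ℂ) * Complex.exp (2 * Real.pi * Complex.I * z) ^ (n : ℕ)

/-- `L_d(z) = E_2(z) - d E_2(dz)`. -/
def L (d : ℕ) (z : ℂ) : ℂ := E2 z - d * E2 (d * z)

/-- `S_4(Γ₀(N))`, the cusp forms of weight `4` for `Γ₀(N)`. -/
abbrev S4 (N : ℕ) : Type := CuspForm (Gamma0 N : Subgroup (GL (Fin 2) ℝ)) 4

/-- On the upper half plane `E2` is Mathlib's weight `2` Eisenstein series. -/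
lemma E2_eq (z : ℍ) : E2 z = EisensteinSeries.E2 z := by
  simp [EisensteinSeries.E2_eq_tsum_cexp, E2]

/-- On the upper half plane `E4` is Mathlib's weight `4` Eisenstein series. -/
lemma E4_eq (z : ℍ) : E4 z = ModularForm.E₄ z := by
  have hb : bernoulli 4 = -1 / 30 := by
    rw [bernoulli_eq_bernoulli'_of_ne_one (by decide), bernoulli'_four]
  have h := EisensteinSeries.q_expansion_bernoulli (k := 4) (by norm_num) (by decide) z
  rw [hb] at h
  norm_num at h
  simp only [E4]
  exact h.symm

end EisensteinConvolution

end

/-! Each claimed error term is holomorphic and modular of weight 4 for `Γ₀(N)`, so it is a cusp form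
once its limit at every cusp is zero (`exists_cuspForm`). For `γ` with lower left entry `c`, write
`diag(d, 1) γ` as an `SL(2, ℤ)` matrix times an upper triangular one. With `t = gcd(c, d) / d`, the
limit is `t ^ 4` for `E4 (d z)` and `1 - d t ^ 2` for `L d` (`hasCuspValues_E4`, `hasCuspValues_L`).
For a prime `p`, `t` is `1` or `1 / p`, and in both cases `t ^ 2 = (1 + p ^ 2 t ^ 4) / (p ^ 2 + 1)`.
For coprime levels `t` is multiplicative. Replacing each `t ^ 2` this way in the limits of the
products of `L`'s gives exactly the stated coefficients. -/

namespace EisensteinConvolution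
open Filter Topology
open scoped Manifold ModularForm

/-! ### Transformation laws under `SL(2, ℤ)` -/

lemma im_moebius_pos {a b c e : ℤ} (h : a * e - b * c = 1) {z : ℂ} (hz : 0 < z.im) :
    0 < ((a * z + b) / (c * z + e)).im := by
  let γ : SL(2, ℤ) := ⟨!![a, b; c, e], by rw [Matrix.det_fin_two_of]; linarith⟩
  have := (γ • (⟨z, hz⟩ : ℍ)).im_pos
  rw [← coe_im, specialLinearGroup_apply] at this
  simpa [γ] using this

lemma linear_ne_zero {a b c e : ℤ} (h : a * e - b * c = 1) {z : ℂ} (hz : 0 < z.im) :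
    (c * z + e : ℂ) ≠ 0 := by
  intro h0
  -- Division by zero gives `0`, whose imaginary part is not positive.
  have := im_moebius_pos h hz
  simp [h0] at this

lemma slash_SL_apply (f : ℂ → ℂ) (k : ℤ) (γ : SL(2, ℤ)) (z : ℍ) :
    ((fun w : ℍ ↦ f w) ∣[k] γ) z
      = f ((γ 0 0 * z + γ 0 1) / (γ 1 0 * z + γ 1 1)) * (γ 1 0 * z + γ 1 1 : ℂ) ^ (-k) := by
  rw [ModularForm.SL_slash_apply, specialLinearGroup_apply]
  simp [ModularGroup.denom_apply]

lemma exists_SL_entries {a b c e : ℤ} (h : a * e - b * c = 1) :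
    ∃ γ : SL(2, ℤ), γ 0 0 = a ∧ γ 0 1 = b ∧ γ 1 0 = c ∧ γ 1 1 = e :=
  ⟨⟨!![a, b; c, e], by rw [Matrix.det_fin_two_of]; exact h⟩, rfl, rfl, rfl, rfl⟩

/-- The constant in the correction term is left unevaluated because it cancels in `L d`. -/
lemma E2_moebius {a b c e : ℤ} (h : a * e - b * c = 1) {z : ℂ} (hz : 0 < z.im) :
    E2 ((a * z + b) / (c * z + e)) = (c * z + e) ^ 2 * E2 z
      - 2 * Real.pi * Complex.I / (2 * riemannZeta 2) * c * (c * z + e) := by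
  obtain ⟨γ, ha, hb, hc, he⟩ := exists_SL_entries h
  have h1 := congrFun (EisensteinSeries.E2_slash_action γ) ⟨z, hz⟩
  have hD : EisensteinSeries.D2 γ ⟨z, hz⟩ = 2 * Real.pi * Complex.I * c / (c * z + e) := by
    rw [EisensteinSeries.D2, ModularGroup.denom_apply, hc, he]
  have h0 := linear_ne_zero h hz
  rw [show EisensteinSeries.E2 = fun w : ℍ ↦ E2 w from funext fun w ↦ (E2_eq w).symm,
    slash_SL_apply, ha, hb, hc, he, Pi.sub_apply, Pi.smul_apply, hD, smul_eq_mul] at h1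
  replace h1 : E2 ((a * z + b) / (c * z + e)) * ((c * z + e) ^ 2)⁻¹ = E2 z
    - 1 / (2 * riemannZeta 2) * (2 * Real.pi * Complex.I * c / (c * z + e)) := h1
  rw [mul_inv_eq_iff_eq_mul₀ (pow_ne_zero 2 h0)] at h1
  rw [h1, sub_mul, mul_comm (E2 z)]
  congr 1
  generalize (c * z + e : ℂ) = j at *
  field_simp

lemma E4_moebius {a b c e : ℤ} (h : a * e - b * c = 1) {z : ℂ} (hz : 0 < z.im) :
    E4 ((a * z + b) / (c * z + e)) = (c * z + e) ^ 4 * E4 z := by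
  obtain ⟨γ, ha, hb, hc, he⟩ := exists_SL_entries h
  have h1 := congrFun (SlashInvariantForm.slash_action_eqn ModularForm.E₄
    (Matrix.SpecialLinearGroup.mapGL ℝ γ) ⟨γ, rfl⟩) ⟨z, hz⟩
  have h0 := linear_ne_zero h hz
  rw [show (ModularForm.E₄ : ℍ → ℂ) = fun w : ℍ ↦ E4 w from funext fun w ↦ (E4_eq w).symm] at h1
  have h2 := slash_SL_apply E4 4 γ ⟨z, hz⟩
  rw [show ((fun w : ℍ ↦ E4 w) ∣[(4 : ℤ)] γ) ⟨z, hz⟩ = E4 z from h1, ha, hb, hc, he] at h2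
  replace h2 : E4 z = E4 ((a * z + b) / (c * z + e)) * ((c * z + e) ^ 4)⁻¹ := h2
  rw [eq_mul_inv_iff_mul_eq₀ (pow_ne_zero 4 h0)] at h2
  rw [← h2, mul_comm]

/-! ### Limits at `i∞` and holomorphy -/

lemma tendsto_tsum_sigma_mul_exp (k : ℕ) :
    Tendsto (fun z : ℂ ↦ ∑' n : ℕ+, (σ k n : ℂ) *
        Complex.exp (2 * Real.pi * Complex.I * z) ^ (n : ℕ))
      (comap Complex.im atTop) (𝓝 0) := by
  -- The series at `z = i` dominates all those with `1 ≤ im z`.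
  have hs := (EisensteinSeries.summable_sigma_mul_cexp_pow (k := k + 1) (by omega) UpperHalfPlane.I).norm
  rw [Nat.add_sub_cancel] at hs
  have hq : Tendsto (fun z : ℂ ↦ Complex.exp (2 * Real.pi * Complex.I * z))
      (comap Complex.im atTop) (𝓝 0) := by
    rw [tendsto_zero_iff_norm_tendsto_zero]
    simp only [Complex.norm_exp]
    refine Real.tendsto_exp_atBot.comp ?_
    have : Tendsto (fun z : ℂ ↦ -(2 * Real.pi) * z.im) (comap Complex.im atTop) atBot :=
      tendsto_comap.const_mul_atTop_of_neg (by linarith [Real.pi_pos])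
    refine this.congr fun z ↦ ?_
    simp
  rw [show (0 : ℂ) = ∑' n : ℕ+, (0 : ℂ) by simp]
  refine tendsto_tsum_of_dominated_convergence (hs.comp_injective PNat.coe_injective) (fun n ↦ ?_) ?_
  · simpa using (hq.pow (n : ℕ)).const_mul (σ k n : ℂ)
  · filter_upwards [preimage_mem_comap (Ioi_mem_atTop 1)] with z hz n
    simp only [Function.comp_apply, norm_mul, norm_pow]
    refine mul_le_mul_of_nonneg_left (pow_le_pow_left₀ (norm_nonneg _) ?_ _) (norm_nonneg _)
    rw [Complex.norm_exp, Complex.norm_exp, Real.exp_le_exp]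
    have : 1 ≤ z.im := le_of_lt hz
    simp
    nlinarith [Real.pi_pos]

lemma tendsto_E2 : Tendsto E2 (comap Complex.im atTop) (𝓝 1) := by
  simpa [E2] using! ((tendsto_tsum_sigma_mul_exp 1).const_mul 24).const_sub 1

lemma tendsto_E4 : Tendsto E4 (comap Complex.im atTop) (𝓝 1) := by
  simpa [E4] using! ((tendsto_tsum_sigma_mul_exp 3).const_mul 240).const_add 1

lemma differentiableOn_E2 : DifferentiableOn ℂ E2 {z | 0 < z.im} :=
  (UpperHalfPlane.mdifferentiable_iff.mp E2_mdifferentiable).congr fun z hz ↦ by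
    simp [ofComplex_apply_of_im_pos hz, ← E2_eq]

lemma differentiableOn_E4 : DifferentiableOn ℂ E4 {z | 0 < z.im} :=
  (UpperHalfPlane.mdifferentiable_iff.mp (ModularFormClass.holo ModularForm.E₄)).congr fun z hz ↦ by
    simp [ofComplex_apply_of_im_pos hz, ← E4_eq]

lemma im_natCast_mul_pos {d : ℕ} (hd : 0 < d) {z : ℂ} (hz : 0 < z.im) : 0 < (d * z : ℂ).im := by
  simpa using mul_pos (Nat.cast_pos.mpr hd) hz

lemma differentiableOn_E4_natCast_mul {d : ℕ} (hd : 0 < d) :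
    DifferentiableOn ℂ (fun z ↦ E4 (d * z)) {z | 0 < z.im} :=
  differentiableOn_E4.comp (by fun_prop) fun _ hz ↦ im_natCast_mul_pos hd hz

lemma differentiableOn_L {d : ℕ} (hd : 0 < d) : DifferentiableOn ℂ (L d) {z | 0 < z.im} :=
  differentiableOn_E2.sub ((differentiableOn_E2.comp (by fun_prop)
    fun _ hz ↦ im_natCast_mul_pos hd hz).const_mul _)

/-- A function on the upper half plane with the growth and invariance of a weight four cusp form
for `Γ₀(N)`, expressed through Möbius maps of `ℂ`, is one. -/
lemma exists_cuspForm {N : ℕ} (hN : 0 < N) {F : ℂ → ℂ} (hF : DifferentiableOn ℂ F {z | 0 < z.im})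
    (hinv : ∀ a b c e : ℤ, a * e - b * c = 1 → (N : ℤ) ∣ c → ∀ z : ℂ, 0 < z.im →
      F ((a * z + b) / (c * z + e)) = (c * z + e) ^ 4 * F z)
    (hlim : ∀ a b c e : ℤ, a * e - b * c = 1 →
      Tendsto (fun z : ℂ ↦ F ((a * z + b) / (c * z + e)) / (c * z + e) ^ 4)
        (comap Complex.im atTop) (𝓝 0)) :
    ∃ C : S4 N, ∀ z : ℍ, C z = F z := by
  have : NeZero N := ⟨hN.ne'⟩
  have hdet (γ : SL(2, ℤ)) : γ 0 0 * γ 1 1 - γ 0 1 * γ 1 0 = 1 := by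
    rw [← Matrix.det_fin_two]; exact γ.det_coe
  refine ⟨{ toFun := fun z ↦ F z, slash_action_eq' := ?_, holo' := ?_, zero_at_cusps' := ?_ },
    fun z ↦ rfl⟩
  · rintro _ ⟨γ, hγ, rfl⟩
    ext z
    refine (slash_SL_apply F 4 γ z).trans ?_
    have hc : (N : ℤ) ∣ γ 1 0 := by
      rwa [← ZMod.intCast_zmod_eq_zero_iff_dvd, ← Gamma0_mem]
    have h0 := linear_ne_zero (hdet γ) z.im_pos
    rw [hinv _ _ _ _ (hdet γ) hc z z.im_pos]
    change _ * ((γ 1 0 * z + γ 1 1 : ℂ) ^ 4)⁻¹ = _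
    rw [mul_inv_eq_iff_eq_mul₀ (pow_ne_zero 4 h0), mul_comm]
  · exact UpperHalfPlane.mdifferentiable_iff.mpr <| hF.congr fun z hz ↦ by
      simp [ofComplex_apply_of_im_pos hz]
  · intro c hc
    -- Every cusp is an `SL(2, ℤ)` translate of `i∞`, so `hlim` covers them all.
    have hc' : IsCusp c 𝒮ℒ := (Subgroup.IsArithmetic.isCusp_iff_isCusp_SL2Z _).mp hc
    rw [OnePoint.isZeroAt_iff_forall_SL2Z hc']
    intro γ _
    refine ((hlim _ _ _ _ (hdet γ)).comp tendsto_coe_atImInfty).congr fun z ↦ ?_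
    rw [slash_SL_apply]
    exact div_eq_mul_inv _ _

/-- Hermite normal form of `diag(d, 1) * γ`. -/
lemma exists_upper_triangular {a b c e : ℤ} (h : a * e - b * c = 1) {d : ℕ} (hd : 0 < d) :
    ∃ a' b' c' e' β δ : ℤ, a' * e' - b' * c' = 1 ∧ 0 < δ ∧ Int.gcd c d * δ = d ∧
      d * a = a' * Int.gcd c d ∧ d * b = a' * β + b' * δ ∧
      c = c' * Int.gcd c d ∧ e = c' * β + e' * δ := by
  have hg : Int.gcd c d ≠ 0 := by simp [Int.gcd_eq_zero_iff, hd.ne']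
  obtain ⟨c', hc'⟩ := Int.gcd_dvd_left c d
  obtain ⟨δ, hδ⟩ := Int.gcd_dvd_right c d
  set g := Int.gcd c d
  have hg' : (0 : ℤ) < g := by omega
  have hδ0 : 0 < δ := by
    have : (0 : ℤ) < g * δ := by omega
    exact pos_of_mul_pos_right this hg'.le
  have hb := Int.gcd_eq_gcd_ab c d
  -- `g = c x + d y`, hence `1 = c' x + δ y`
  set x := Int.gcdA c d
  set y := Int.gcdB c d
  have h1 : c' * x + δ * y = 1 := by
    have : (g : ℤ) * (c' * x + δ * y) = g * 1 := by
      rw [mul_one]; conv_rhs => rw [show (g : ℤ) = _ from hb]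
      rw [hc', hδ]; ring
    exact mul_left_cancel₀ hg'.ne' this
  -- first column `(a δ, c')` has inverse row `(u, v)`
  obtain ⟨u, v, huv⟩ : ∃ u v : ℤ, u * (a * δ) + v * c' = 1 := by
    have h2 : IsCoprime (a * δ) c' := by
      refine IsCoprime.mul_left ⟨e, -b * g, ?_⟩ ⟨y, x, by linarith⟩
      linear_combination h + b * hc'
    exact h2
  -- The last two witnesses are the inverse of `!![a δ, -v; c', u]` applied to the column `(d b,
  -- e)`.
  refine ⟨a * δ, -v, c', u, u * d * b + v * e, δ * (a * e - b * c), ?_, ?_, ?_, ?_, ?_, ?_, ?_⟩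
  · linear_combination huv
  · rwa [h, mul_one]
  · rw [h, mul_one, hδ]
  · rw [hδ]; ring
  · rw [h, hδ]
    linear_combination (-(g * δ * b)) * huv - v * δ * (h + b * hc')
  · rw [mul_comm]; exact hc'
  · rw [h, hδ]
    linear_combination (-e) * huv + u * δ * (h + b * hc')

/-! ### Values at the cusps -/

/-- `F` is holomorphic and modular of weight `k` for `Γ₀(N)` on the upper half plane, and for every
`γ ∈ SL(2, ℤ)` with lower left entry `c`, the function `F ∣[k] γ` tends to `v c` at `i∞`. -/
structure HasCuspValues (N k : ℕ) (F : ℂ → ℂ) (v : ℤ → ℂ) : Prop where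
  holo : DifferentiableOn ℂ F {z | 0 < z.im}
  inv : ∀ a b c e : ℤ, a * e - b * c = 1 → (N : ℤ) ∣ c → ∀ z : ℂ, 0 < z.im →
    F ((a * z + b) / (c * z + e)) = (c * z + e) ^ k * F z
  lim : ∀ a b c e : ℤ, a * e - b * c = 1 →
    Tendsto (fun z : ℂ ↦ F ((a * z + b) / (c * z + e)) / (c * z + e) ^ k)
      (comap Complex.im atTop) (𝓝 (v c))

namespace HasCuspValues

variable {N k l : ℕ} {F G : ℂ → ℂ} {v w : ℤ → ℂ}

lemma add (hF : HasCuspValues N k F v) (hG : HasCuspValues N k G w) :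
    HasCuspValues N k (fun z ↦ F z + G z) (fun c ↦ v c + w c) where
  holo := hF.holo.add hG.holo
  inv a b c e h hc z hz := by rw [hF.inv a b c e h hc z hz, hG.inv a b c e h hc z hz]; ring
  lim a b c e h := ((hF.lim a b c e h).add (hG.lim a b c e h)).congr fun z ↦ by ring

lemma sub (hF : HasCuspValues N k F v) (hG : HasCuspValues N k G w) :
    HasCuspValues N k (fun z ↦ F z - G z) (fun c ↦ v c - w c) where
  holo := hF.holo.sub hG.holo
  inv a b c e h hc z hz := by rw [hF.inv a b c e h hc z hz, hG.inv a b c e h hc z hz]; ring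
  lim a b c e h := ((hF.lim a b c e h).sub (hG.lim a b c e h)).congr fun z ↦ by ring

lemma const_mul (r : ℂ) (hF : HasCuspValues N k F v) :
    HasCuspValues N k (fun z ↦ r * F z) (fun c ↦ r * v c) where
  holo := hF.holo.const_mul r
  inv a b c e h hc z hz := by rw [hF.inv a b c e h hc z hz]; ring
  lim a b c e h := ((hF.lim a b c e h).const_mul r).congr fun z ↦ by ring

lemma mul (hF : HasCuspValues N k F v) (hG : HasCuspValues N l G w) :
    HasCuspValues N (k + l) (fun z ↦ F z * G z) (fun c ↦ v c * w c) where
  holo := hF.holo.mul hG.holo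
  inv a b c e h hc z hz := by rw [hF.inv a b c e h hc z hz, hG.inv a b c e h hc z hz]; ring
  lim a b c e h := ((hF.lim a b c e h).mul (hG.lim a b c e h)).congr fun z ↦ by
    rw [div_mul_div_comm, pow_add]

lemma exists_cuspForm (hN : 0 < N) (hF : HasCuspValues N 4 F v) (hv : ∀ c, v c = 0) :
    ∃ C : S4 N, ∀ z : ℍ, C z = F z :=
  EisensteinConvolution.exists_cuspForm hN hF.holo hF.inv fun a b c e h ↦ hv c ▸ hF.lim a b c e h

end HasCuspValues

/-- Behaviour of `z ↦ E4 (d z)` and `L d` under a Möbius map with lower left entry `c`. -/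
lemma E4_L_natCast_mul_moebius {a b c e : ℤ} (h : a * e - b * c = 1) {d : ℕ} (hd : 0 < d) :
    ∃ β δ : ℤ, 0 < δ ∧ Int.gcd c d * δ = d ∧ ∀ z : ℂ, 0 < z.im →
      E4 (d * ((a * z + b) / (c * z + e)))
        = (c * z + e) ^ 4 * (E4 ((Int.gcd c d * z + β) / δ) / δ ^ 4) ∧
      L d ((a * z + b) / (c * z + e))
        = (c * z + e) ^ 2 * (E2 z - d / δ ^ 2 * E2 ((Int.gcd c d * z + β) / δ)) := by
  obtain ⟨a', b', c', e', β, δ, h', hδ, hgδ, ha, hb, hc, he⟩ := exists_upper_triangular h hd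
  refine ⟨β, δ, hδ, hgδ, fun z hz ↦ ?_⟩
  have hg : 0 < Int.gcd c d := Int.gcd_pos_of_ne_zero_right _ (by exact_mod_cast hd.ne')
  set g := Int.gcd c d
  have hδC : (δ : ℂ) ≠ 0 := by exact_mod_cast hδ.ne'
  have hw : 0 < ((g * z + β) / δ : ℂ).im := by
    rw [show (δ : ℂ) = ((δ : ℝ) : ℂ) by simp, Complex.div_ofReal_im]
    have : 0 < (g : ℝ) * z.im := mul_pos (Nat.cast_pos.mpr hg) hz
    have : (0 : ℝ) < δ := by exact_mod_cast hδ
    simp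
    positivity
  have hj := linear_ne_zero h hz
  have hgδC : (g : ℂ) * δ = d := by exact_mod_cast hgδ
  have haC : (d : ℂ) * a = a' * g := by exact_mod_cast ha
  have hbC : (d : ℂ) * b = a' * β + b' * δ := by exact_mod_cast hb
  have hcC : (c : ℂ) = c' * g := by exact_mod_cast hc
  have heC : (e : ℂ) = c' * β + e' * δ := by exact_mod_cast he
  have hden : c' * ((g * z + β) / δ : ℂ) + e' = (c * z + e) / δ := by
    rw [hcC, heC]; field_simp; ring
  have hnum : a' * ((g * z + β) / δ : ℂ) + b' = d * (a * z + b) / δ := by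
    rw [mul_add, ← mul_assoc, haC, hbC]; field_simp; ring
  have key : (d : ℂ) * ((a * z + b) / (c * z + e))
      = (a' * ((g * z + β) / δ : ℂ) + b') / (c' * ((g * z + β) / δ : ℂ) + e') := by
    rw [hden, hnum]; field_simp
  rw [L, key, E4_moebius h' hw, E2_moebius h' hw, E2_moebius h hz, hden]
  generalize (g * z + β) / (δ : ℂ) = w
  generalize hJ : (c * z + e : ℂ) = J at *
  refine ⟨by ring, ?_⟩
  rw [hcC, ← hgδC]
  -- The two correction terms cancel, since `d c' / δ = g c' = c`.
  generalize 2 * Real.pi * Complex.I / (2 * riemannZeta 2) = K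
  field_simp
  ring

lemma E_add_intCast (β : ℤ) {z : ℂ} (hz : 0 < z.im) : E2 (z + β) = E2 z ∧ E4 (z + β) = E4 z := by
  have h : (1 : ℤ) * 1 - β * 0 = 1 := by ring
  exact ⟨by simpa using E2_moebius h hz, by simpa using E4_moebius h hz⟩

lemma tendsto_linear {g : ℕ} (hg : 0 < g) (β : ℤ) {δ : ℤ} (hδ : 0 < δ) :
    Tendsto (fun z : ℂ ↦ (g * z + β) / δ) (comap Complex.im atTop) (comap Complex.im atTop) := by
  rw [tendsto_comap_iff]
  have h : (0 : ℝ) < g / δ := div_pos (Nat.cast_pos.mpr hg) (by exact_mod_cast hδ)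
  refine (tendsto_comap.const_mul_atTop h).congr fun z ↦ ?_
  rw [Function.comp_apply, show (δ : ℂ) = ((δ : ℝ) : ℂ) by simp, Complex.div_ofReal_im]
  simp
  ring

lemma eventually_im_pos : ∀ᶠ z : ℂ in comap Complex.im atTop, 0 < z.im :=
  preimage_mem_comap (Ioi_mem_atTop 0)

/-- Here `d ∣ c` forces `gcd(c, d) = d` and `δ = 1`; the remaining shift by `β` is absorbed by
periodicity. -/
lemma moebius_of_dvd {N d : ℕ} (hd : 0 < d) (hdN : d ∣ N) {a b c e : ℤ} (h : a * e - b * c = 1)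
    (hc : (N : ℤ) ∣ c) {z : ℂ} (hz : 0 < z.im) :
    E4 (d * ((a * z + b) / (c * z + e))) = (c * z + e) ^ 4 * E4 (d * z) ∧
      L d ((a * z + b) / (c * z + e)) = (c * z + e) ^ 2 * L d z := by
  obtain ⟨β, δ, hδ, hgδ, hE⟩ := E4_L_natCast_mul_moebius h hd
  have hg : Int.gcd c d = d :=
    Nat.gcd_eq_right (Int.natCast_dvd.mp ((Int.natCast_dvd_natCast.mpr hdN).trans hc))
  rw [hg] at hgδ hE
  have hδ1 : δ = 1 := by
    have : (d : ℤ) ≠ 0 := by exact_mod_cast hd.ne'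
    exact mul_left_cancel₀ this (by rw [hgδ, mul_one])
  obtain ⟨h2, h4⟩ := E_add_intCast β (im_natCast_mul_pos hd hz)
  simpa [hδ1, h2, h4, L] using hE z hz

lemma natCast_gcd_div {c : ℤ} {d : ℕ} (hd : 0 < d) {δ : ℤ} (hδ : 0 < δ)
    (hgδ : Int.gcd c d * δ = d) : (Int.gcd c d / d : ℂ) = 1 / δ := by
  have h1 : (Int.gcd c d : ℂ) * δ = d := by exact_mod_cast hgδ
  have hδC : (δ : ℂ) ≠ 0 := by exact_mod_cast hδ.ne'
  have hdC : (d : ℂ) ≠ 0 := by exact_mod_cast hd.ne'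
  rw [div_eq_div_iff hdC hδC, h1, one_mul]

/-- The inner argument still tends to `i∞`, where `E4` tends to `1`; only the factor `δ⁻⁴` survives,
and `1 / δ = gcd(c, d) / d`. -/
lemma hasCuspValues_E4 {N d : ℕ} (hd : 0 < d) (hdN : d ∣ N) :
    HasCuspValues N 4 (fun z ↦ E4 (d * z)) (fun c ↦ (Int.gcd c d / d : ℂ) ^ 4) where
  holo := differentiableOn_E4_natCast_mul hd
  inv _ _ _ _ h hc _ hz := (moebius_of_dvd hd hdN h hc hz).1
  lim a b c e h := by
    obtain ⟨β, δ, hδ, hgδ, hE⟩ := E4_L_natCast_mul_moebius h hd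
    have hg : 0 < Int.gcd c d := Int.gcd_pos_of_ne_zero_right _ (by exact_mod_cast hd.ne')
    rw [natCast_gcd_div hd hδ hgδ, div_pow, one_pow]
    refine ((tendsto_E4.comp (tendsto_linear hg β hδ)).div_const _).congr' ?_
    filter_upwards [eventually_im_pos] with z hz
    rw [(hE z hz).1, mul_div_cancel_left₀ _ (pow_ne_zero 4 (linear_ne_zero h hz))]
    rfl

lemma hasCuspValues_L {N d : ℕ} (hd : 0 < d) (hdN : d ∣ N) :
    HasCuspValues N 2 (L d) (fun c ↦ 1 - d * (Int.gcd c d / d : ℂ) ^ 2) where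
  holo := differentiableOn_L hd
  inv _ _ _ _ h hc _ hz := (moebius_of_dvd hd hdN h hc hz).2
  lim a b c e h := by
    obtain ⟨β, δ, hδ, hgδ, hE⟩ := E4_L_natCast_mul_moebius h hd
    have hg : 0 < Int.gcd c d := Int.gcd_pos_of_ne_zero_right _ (by exact_mod_cast hd.ne')
    rw [natCast_gcd_div hd hδ hgδ]
    have hlim := tendsto_E2.sub
      ((tendsto_E2.comp (tendsto_linear hg β hδ)).const_mul (d / δ ^ 2 : ℂ))
    rw [show (1 - d / δ ^ 2 * 1 : ℂ) = 1 - d * (1 / δ) ^ 2 by ring] at hlim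
    refine hlim.congr' ?_
    filter_upwards [eventually_im_pos] with z hz
    rw [(hE z hz).2, mul_div_cancel_left₀ _ (pow_ne_zero 2 (linear_ne_zero h hz))]
    rfl

/-! ### Matching cusp values at levels `p` and `p₁ p₂` -/

lemma gcd_prime_div (c : ℤ) {p : ℕ} (hp : p.Prime) :
    (Int.gcd c p / p : ℂ) = 1 ∨ (Int.gcd c p / p : ℂ) = 1 / p := by
  have hpC : (p : ℂ) ≠ 0 := by exact_mod_cast hp.ne_zero
  rcases (Nat.dvd_prime hp).mp (Int.gcd_dvd_natAbs_right c p) with h | h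
  · right; rw [h, Nat.cast_one]
  · left; rw [h, div_self hpC]

lemma natCast_sq_add_one_ne_zero (n : ℕ) : (n : ℂ) ^ 2 + 1 ≠ 0 := by
  exact_mod_cast (n ^ 2).succ_ne_zero

lemma hasCuspValues_E4_self (N : ℕ) : HasCuspValues N 4 E4 (fun _ ↦ 1) := by
  simpa using hasCuspValues_E4 one_pos (one_dvd N)

lemma exists_cuspForm_prime {p : ℕ} (hp : p.Prime) :
    ∃ C : S4 p, ∀ z : ℍ, C z = L p z * L p z
      - ((p : ℂ) - 1) ^ 2 / ((p : ℂ) ^ 2 + 1) * E4 z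
      - (p : ℂ) ^ 2 * ((p : ℂ) - 1) ^ 2 / ((p : ℂ) ^ 2 + 1) * E4 (p * z) := by
  have hL := hasCuspValues_L hp.pos dvd_rfl
  have hE := hasCuspValues_E4 hp.pos (dvd_refl p)
  refine (((hL.mul hL).sub ((hasCuspValues_E4_self p).const_mul _)).sub
    (hE.const_mul _)).exists_cuspForm hp.pos fun c ↦ ?_
  have h0 := natCast_sq_add_one_ne_zero p
  have hpC : (p : ℂ) ≠ 0 := by exact_mod_cast hp.ne_zero
  rcases gcd_prime_div c hp with h | h <;> rw [h] <;> field_simp <;> ring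

lemma gcd_mul_div (c : ℤ) {m n : ℕ} (h : m.Coprime n) :
    (Int.gcd c (m * n : ℕ) / (m * n : ℕ) : ℂ) = (Int.gcd c m / m) * (Int.gcd c n / n) := by
  have : Int.gcd c (m * n : ℕ) = Int.gcd c m * Int.gcd c n := h.gcd_mul c.natAbs
  rw [this]
  push_cast
  rw [div_mul_div_comm]

/-- The coefficients are the product over both primes of `1 - p t ^ 2 = ((p ^ 2 - p + 1) - p ^ 3 t ^
4) / (p ^ 2 + 1)`, valid for `t = 1` and `t = 1 / p`. -/
lemma exists_cuspForm_mul {p₁ p₂ : ℕ} (hp₁ : p₁.Prime) (hp₂ : p₂.Prime) (hne : p₁ ≠ p₂) :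
    ∃ C : S4 (p₁ * p₂), ∀ z : ℍ, C z = L p₁ z * L p₂ z
      - ((p₁ : ℂ) ^ 2 - p₁ + 1) * ((p₂ : ℂ) ^ 2 - p₂ + 1)
          / (((p₁ : ℂ) ^ 2 + 1) * ((p₂ : ℂ) ^ 2 + 1)) * E4 z
      + (p₁ : ℂ) ^ 3 * ((p₂ : ℂ) ^ 2 - p₂ + 1)
          / (((p₁ : ℂ) ^ 2 + 1) * ((p₂ : ℂ) ^ 2 + 1)) * E4 (p₁ * z)
      + (p₂ : ℂ) ^ 3 * ((p₁ : ℂ) ^ 2 - p₁ + 1)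
          / (((p₁ : ℂ) ^ 2 + 1) * ((p₂ : ℂ) ^ 2 + 1)) * E4 (p₂ * z)
      - (p₁ : ℂ) ^ 3 * (p₂ : ℂ) ^ 3
          / (((p₁ : ℂ) ^ 2 + 1) * ((p₂ : ℂ) ^ 2 + 1)) * E4 ((p₁ * p₂ : ℕ) * z) := by
  have hN := Nat.mul_pos hp₁.pos hp₂.pos
  have d₁ := dvd_mul_right p₁ p₂
  have d₂ := dvd_mul_left p₂ p₁
  refine ((((((hasCuspValues_L hp₁.pos d₁).mul (hasCuspValues_L hp₂.pos d₂)).sub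
    ((hasCuspValues_E4_self _).const_mul _)).add
    ((hasCuspValues_E4 hp₁.pos d₁).const_mul _)).add
    ((hasCuspValues_E4 hp₂.pos d₂).const_mul _)).sub
    ((hasCuspValues_E4 hN dvd_rfl).const_mul _)).exists_cuspForm hN fun c ↦ ?_
  rw [gcd_mul_div c ((Nat.coprime_primes hp₁ hp₂).mpr hne)]
  have h₁ := natCast_sq_add_one_ne_zero p₁
  have h₂ := natCast_sq_add_one_ne_zero p₂
  have hpC₁ : (p₁ : ℂ) ≠ 0 := by exact_mod_cast hp₁.ne_zero
  have hpC₂ : (p₂ : ℂ) ≠ 0 := by exact_mod_cast hp₂.ne_zero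
  rcases gcd_prime_div c hp₁ with h | h <;> rcases gcd_prime_div c hp₂ with h' | h' <;>
    rw [h, h'] <;> field_simp <;> ring

/-- In `(1 - p₁ p₂ t₁ ^ 2 t₂ ^ 2) ^ 2` only the cross term needs rewriting in fourth powers, which
yields the coefficients with a factor `2`. -/
lemma exists_cuspForm_sq {p₁ p₂ : ℕ} (hp₁ : p₁.Prime) (hp₂ : p₂.Prime) (hne : p₁ ≠ p₂) :
    ∃ C : S4 (p₁ * p₂), ∀ z : ℍ, C z = L (p₁ * p₂) z * L (p₁ * p₂) z
      - (1 - 2 * (p₁ : ℂ) * p₂ / (((p₁ : ℂ) ^ 2 + 1) * ((p₂ : ℂ) ^ 2 + 1))) * E4 z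
      + 2 * (p₁ : ℂ) ^ 3 * p₂ / (((p₁ : ℂ) ^ 2 + 1) * ((p₂ : ℂ) ^ 2 + 1)) * E4 (p₁ * z)
      + 2 * (p₁ : ℂ) * (p₂ : ℂ) ^ 3 / (((p₁ : ℂ) ^ 2 + 1) * ((p₂ : ℂ) ^ 2 + 1)) * E4 (p₂ * z)
      - ((p₁ : ℂ) ^ 2 * (p₂ : ℂ) ^ 2 - 2 * (p₁ : ℂ) ^ 3 * (p₂ : ℂ) ^ 3
          / (((p₁ : ℂ) ^ 2 + 1) * ((p₂ : ℂ) ^ 2 + 1))) * E4 ((p₁ * p₂ : ℕ) * z) := by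
  have hN := Nat.mul_pos hp₁.pos hp₂.pos
  have d₁ := dvd_mul_right p₁ p₂
  have d₂ := dvd_mul_left p₂ p₁
  have hL := hasCuspValues_L hN dvd_rfl
  refine (((((hL.mul hL).sub
    ((hasCuspValues_E4_self _).const_mul _)).add
    ((hasCuspValues_E4 hp₁.pos d₁).const_mul _)).add
    ((hasCuspValues_E4 hp₂.pos d₂).const_mul _)).sub
    ((hasCuspValues_E4 hN dvd_rfl).const_mul _)).exists_cuspForm hN fun c ↦ ?_
  rw [gcd_mul_div c ((Nat.coprime_primes hp₁ hp₂).mpr hne)]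
  have h₁ := natCast_sq_add_one_ne_zero p₁
  have h₂ := natCast_sq_add_one_ne_zero p₂
  have hpC₁ : (p₁ : ℂ) ≠ 0 := by exact_mod_cast hp₁.ne_zero
  have hpC₂ : (p₂ : ℂ) ≠ 0 := by exact_mod_cast hp₂.ne_zero
  push_cast
  rcases gcd_prime_div c hp₁ with h | h <;> rcases gcd_prime_div c hp₂ with h' | h' <;>
    rw [h, h'] <;> field_simp <;> ring

end EisensteinConvolution

theorem mainTheorem1 :
    (∀ p : ℕ, p.Prime →
      ∃ C : EisensteinConvolution.S4 p, ∀ z : ℍ,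
        EisensteinConvolution.L p z ^ 2
          = ((p : ℂ) - 1) ^ 2 / ((p : ℂ) ^ 2 + 1) * EisensteinConvolution.E4 z
          + (p : ℂ) ^ 2 * ((p : ℂ) - 1) ^ 2 / ((p : ℂ) ^ 2 + 1)
              * EisensteinConvolution.E4 (p * z)
          + C z) ∧
    (∀ p₁ p₂ : ℕ, p₁.Prime → p₂.Prime → p₁ ≠ p₂ →
      (∃ C : EisensteinConvolution.S4 (p₁ * p₂), ∀ z : ℍ,
        EisensteinConvolution.L p₁ z * EisensteinConvolution.L p₂ z
          = ((p₁ : ℂ) ^ 2 - p₁ + 1) * ((p₂ : ℂ) ^ 2 - p₂ + 1)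
                / (((p₁ : ℂ) ^ 2 + 1) * ((p₂ : ℂ) ^ 2 + 1)) * EisensteinConvolution.E4 z
          - (p₁ : ℂ) ^ 3 * ((p₂ : ℂ) ^ 2 - p₂ + 1)
                / (((p₁ : ℂ) ^ 2 + 1) * ((p₂ : ℂ) ^ 2 + 1))
              * EisensteinConvolution.E4 (p₁ * z)
          - (p₂ : ℂ) ^ 3 * ((p₁ : ℂ) ^ 2 - p₁ + 1)
                / (((p₁ : ℂ) ^ 2 + 1) * ((p₂ : ℂ) ^ 2 + 1))
              * EisensteinConvolution.E4 (p₂ * z)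
          + (p₁ : ℂ) ^ 3 * (p₂ : ℂ) ^ 3
                / (((p₁ : ℂ) ^ 2 + 1) * ((p₂ : ℂ) ^ 2 + 1))
              * EisensteinConvolution.E4 (p₁ * p₂ * z)
          + C z) ∧
      (∃ C : EisensteinConvolution.S4 (p₁ * p₂), ∀ z : ℍ,
        EisensteinConvolution.L (p₁ * p₂) z ^ 2
          = (1 - 2 * (p₁ : ℂ) * p₂ / (((p₁ : ℂ) ^ 2 + 1) * ((p₂ : ℂ) ^ 2 + 1)))
              * EisensteinConvolution.E4 z
          - 2 * (p₁ : ℂ) ^ 3 * p₂ / (((p₁ : ℂ) ^ 2 + 1) * ((p₂ : ℂ) ^ 2 + 1))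
              * EisensteinConvolution.E4 (p₁ * z)
          - 2 * (p₁ : ℂ) * (p₂ : ℂ) ^ 3 / (((p₁ : ℂ) ^ 2 + 1) * ((p₂ : ℂ) ^ 2 + 1))
              * EisensteinConvolution.E4 (p₂ * z)
          + ((p₁ : ℂ) ^ 2 * (p₂ : ℂ) ^ 2
                - 2 * (p₁ : ℂ) ^ 3 * (p₂ : ℂ) ^ 3
                  / (((p₁ : ℂ) ^ 2 + 1) * ((p₂ : ℂ) ^ 2 + 1)))
              * EisensteinConvolution.E4 (p₁ * p₂ * z)
          + C z)) := by
  refine ⟨fun p hp ↦ ?_, fun p₁ p₂ hp₁ hp₂ hne ↦ ⟨?_, ?_⟩⟩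
  · obtain ⟨C, hC⟩ := EisensteinConvolution.exists_cuspForm_prime hp
    exact ⟨C, fun z ↦ by rw [hC]; ring⟩
  · obtain ⟨C, hC⟩ := EisensteinConvolution.exists_cuspForm_mul hp₁ hp₂ hne
    exact ⟨C, fun z ↦ by rw [hC]; push_cast; ring⟩
  · obtain ⟨C, hC⟩ := EisensteinConvolution.exists_cuspForm_sq hp₁ hp₂ hne
    exact ⟨C, fun z ↦ by rw [hC]; push_cast; ring⟩
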